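/- All Hilbert spaces are complex, $B(H)$ is the algebra of bounded operators on $H$, and $a\circ b=\frac12(ab+ba)$. A *Jordan operator algebra* on $H$ is a norm-closed linear subspace $A$ of $B(H)$ with $a\circ b\in A$ for all $a,b\in A$. A *Jordan homomorphism* is a linear map $T$ with $T(a\circ b)=T(a)\circ T(b)$. A *unitization* of a Jordan operator algebra $A$ is a pair $(U,j)$, where $U$ is a Jordan operator algebra on a Hilbert space $L$ with $I_L\in U$ and $j:A\to U$ is an isometric Jordan homomorphism with $U=j(A)+\mathbb{C}I_L$ and $I_L\notin j(A)$ (so $j(A)$ has codimension one in $U$). Let $A$ and $B$ be Jordan operator algebras on $H$ and $K$ respectively. 1. Suppose $I_H\notin A$. Every contractive Jordan homomorphism $T:A\to B$ extends to a contractive Jordan homomorphism $S:A+\mathbb{C}I_H\to B+\mathbb{C}I_K$ with $S(I_H)=I_K$. 2. Suppose $I_H\notin A$ and $I_K\notin B$. Every isometric Jordan homomorphism $T:A\to B$ extends to an isometric Jordan homomorphism $S:A+\mathbb{C}I_H\to B+\mathbb{C}I_K$ with $S(I_H)=I_K$. 3. Every Jordan operator algebra $A$ has a unitization; if $I_H\notin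 A$, then $A+\mathbb{C}I_H$ with the inclusion of $A$ is one. The unitization is unique up to isometric Jordan isomorphism: if $(U_1,j_1)$ and $(U_2,j_2)$ are unitizations of $A$, with $U_i$ acting on $L_i$, then there is a surjective linear isometry $\varphi:U_1\to U_2$ which is a Jordan homomorphism with $\varphi(I_{L_1})=I_{L_2}$ and $\varphi\circ j_1=j_2$. -/

import Mathlib

universe u v w x

/-- The Jordan product `a ∘ b = (ab + ba)/2` of two bounded operators on `H`. -/
noncomputable def jordanProd {H : Type u} [NormedAddCommGroup H] [InnerProductSpace ℂ H]
    (a b : H →L[ℂ] H) : H →L[ℂ] H :=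
  (1 / 2 : ℂ) • (a * b + b * a)

/-- A Jordan operator algebra on a complex Hilbert space `H`: a norm-closed complex linear subspace
of `B(H)` which is closed under the Jordan product. -/
structure JordanOperatorAlgebra (H : Type u) [NormedAddCommGroup H] [InnerProductSpace ℂ H]
    [CompleteSpace H] extends Submodule ℂ (H →L[ℂ] H) where
  isClosed' : IsClosed (toSubmodule : Set (H →L[ℂ] H))
  jordanProd_mem' : ∀ a ∈ toSubmodule, ∀ b ∈ toSubmodule, jordanProd a b ∈ toSubmodule

namespace JordanOperatorAlgebra

/-- A Jordan operator algebra, as a type, carries the linear structure and the norm of `B(H)`. -/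
instance {H : Type u} [NormedAddCommGroup H] [InnerProductSpace ℂ H] [CompleteSpace H] :
    CoeSort (JordanOperatorAlgebra H) (Type u) :=
  ⟨fun A => A.toSubmodule⟩

/-- The Jordan product on a Jordan operator algebra. -/
noncomputable def jmul {H : Type u} [NormedAddCommGroup H] [InnerProductSpace ℂ H]
    [CompleteSpace H] {A : JordanOperatorAlgebra H} (a b : A) : A :=
  ⟨jordanProd (a : H →L[ℂ] H) (b : H →L[ℂ] H), A.jordanProd_mem' a a.2 b b.2⟩

/-- A linear map between Jordan operator algebras is a Jordan homomorphism if it preserves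
the Jordan product. -/
def IsJordanHom {H : Type u} [NormedAddCommGroup H] [InnerProductSpace ℂ H] [CompleteSpace H]
    {K : Type v} [NormedAddCommGroup K] [InnerProductSpace ℂ K] [CompleteSpace K]
    {A : JordanOperatorAlgebra H} {B : JordanOperatorAlgebra K} (T : A →ₗ[ℂ] B) : Prop :=
  ∀ a b : A, T (jmul a b) = jmul (T a) (T b)

/-- The Jordan operator algebra `A + ℂ I_H` on the Hilbert space `H` on which `A` acts. -/
noncomputable def adjoinOne {H : Type u} [NormedAddCommGroup H] [InnerProductSpace ℂ H]
    [CompleteSpace H] (A : JordanOperatorAlgebra H) : JordanOperatorAlgebra H where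
  toSubmodule := A.toSubmodule ⊔ Submodule.span ℂ {(1 : H →L[ℂ] H)}
  isClosed' := Submodule.isClosed_sup_finiteDimensional _ _ A.isClosed'
  jordanProd_mem' := by
    intro x hx y hy
    obtain ⟨a, ha, s, hs, rfl⟩ := Submodule.mem_sup.1 hx
    obtain ⟨b, hb, t, ht, rfl⟩ := Submodule.mem_sup.1 hy
    obtain ⟨c, rfl⟩ := Submodule.mem_span_singleton.1 hs
    obtain ⟨d, rfl⟩ := Submodule.mem_span_singleton.1 ht
    refine Submodule.mem_sup.2 ⟨jordanProd a b + d • a + c • b,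
      A.toSubmodule.add_mem (A.toSubmodule.add_mem (A.jordanProd_mem' a ha b hb)
        (A.toSubmodule.smul_mem d ha)) (A.toSubmodule.smul_mem c hb), (c * d) • 1,
      Submodule.smul_mem _ _ (Submodule.mem_span_singleton_self _), ?_⟩
    simp only [jordanProd, mul_add, add_mul, smul_mul_assoc, mul_smul_comm, mul_one, one_mul]
    module

/-- The identity operator `I_H`, as an element of `A + ℂ I_H`. -/
noncomputable def adjoinOneOne {H : Type u} [NormedAddCommGroup H] [InnerProductSpace ℂ H]
    [CompleteSpace H] (A : JordanOperatorAlgebra H) : A.adjoinOne :=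
  ⟨1, Submodule.mem_sup_right (Submodule.mem_span_singleton_self _)⟩

/-- The inclusion of `A` in `A + ℂ I_H`. -/
noncomputable def toAdjoinOne {H : Type u} [NormedAddCommGroup H] [InnerProductSpace ℂ H]
    [CompleteSpace H] (A : JordanOperatorAlgebra H) : A →ₗ[ℂ] A.adjoinOne :=
  Submodule.inclusion le_sup_left

/-- `(U, j)` is a unitization of the Jordan operator algebra `A`: `U` is a Jordan operator algebra
on a Hilbert space `L` which contains `I_L`, `j` is an isometric Jordan homomorphism of `A` into
`U`, and `U = j(A) + ℂ I_L` with `I_L ∉ j(A)`, so that `j(A)` has codimension one in `U`. -/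
structure IsUnitization {H : Type u} [NormedAddCommGroup H] [InnerProductSpace ℂ H]
    [CompleteSpace H] {L : Type v} [NormedAddCommGroup L] [InnerProductSpace ℂ L]
    [CompleteSpace L] {A : JordanOperatorAlgebra H} (U : JordanOperatorAlgebra L)
    (j : A →ₗ[ℂ] U) : Prop where
  one_mem : (1 : L →L[ℂ] L) ∈ U.toSubmodule
  isJordanHom : IsJordanHom j
  norm_map : ∀ a : A, ‖j a‖ = ‖a‖
  one_ne : ∀ a : A, (j a : L →L[ℂ] L) ≠ 1
  exists_eq : ∀ x : U, ∃ (a : A) (c : ℂ), (x : L →L[ℂ] L) = (j a : L →L[ℂ] L) + c • 1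

end JordanOperatorAlgebra

/-! Everything rests on one inequality, `norm_add_smul_one_le`: if `f` is an isometric
representation of `A` omitting the identity and `g` a contractive one, then `‖g a + c‖ ≤ ‖f a + c‖`.
After scaling, `x = f a + c` is a strict contraction. As the identity is omitted, `|c| < 1`, so the
disc automorphism sending `c` to `0` turns `x` into `(x - c)(1 - c̄x)⁻¹`. This has no scalar part,
hence equals `f y` with `‖y‖ ≤ 1`. Then `g y` is a contraction, and the inverse automorphism sends
it to `g a + c`.

Contractive extension is this inequality; isometric extension and uniqueness use it in both
directions. Existence reduces to a representation omitting the identity. -/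

/-! ### Möbius transforms and scalar parts -/

/-- The Möbius transform of a contraction on a Hilbert space is a contraction. -/
theorem norm_le_one_of_mul_one_add_conj_smul {K : Type*} [NormedAddCommGroup K]
    [InnerProductSpace ℂ K] [CompleteSpace K] {s z : K →L[ℂ] K} {c : ℂ}
    (hs : ‖s‖ ≤ 1) (hc : ‖c‖ < 1) (h : z * (1 + (starRingEnd ℂ) c • s) = s + c • 1) :
    ‖z‖ ≤ 1 := by
  have hlt : ‖-((starRingEnd ℂ) c • s)‖ < 1 := by
    rw [norm_neg, norm_smul, RCLike.norm_conj]
    exact (mul_le_of_le_one_right (norm_nonneg _) hs).trans_lt hc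
  have hu : IsUnit (1 + (starRingEnd ℂ) c • s) := by
    simpa using isUnit_one_sub_of_norm_lt_one hlt
  obtain ⟨v, hv⟩ := hu.exists_right_inv
  refine ContinuousLinearMap.opNorm_le_bound _ zero_le_one fun η => ?_
  have hη : η = v η + (starRingEnd ℂ) c • s (v η) := by
    have := congrArg (fun w : K →L[ℂ] K => w η) hv
    simpa using this.symm
  have hz : z η = s (v η) + c • v η := by
    have := congrArg (fun w : K →L[ℂ] K => w (v η)) h
    simpa [← hη] using this
  set ξ := v η
  have hsξ : ‖s ξ‖ ≤ ‖ξ‖ := by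
    simpa using s.le_of_opNorm_le hs ξ
  rw [one_mul, hz, hη]
  -- The cross terms agree, so the squared norms differ by `(1 - ‖c‖²)(‖ξ‖² - ‖s ξ‖²)`.
  refine le_of_sq_le_sq ?_ (norm_nonneg _)
  rw [@norm_add_sq ℂ, @norm_add_sq ℂ, norm_smul, norm_smul, RCLike.norm_conj]
  have hin : RCLike.re (inner ℂ (s ξ) (c • ξ)) =
      RCLike.re (inner ℂ ξ ((starRingEnd ℂ) c • s ξ)) := by
    rw [← inner_conj_symm, RCLike.conj_re, inner_smul_left, inner_smul_right]
  rw [hin]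
  have h1 : ‖c‖ ^ 2 ≤ 1 := pow_le_one₀ (norm_nonneg _) hc.le
  have h2 : ‖s ξ‖ ^ 2 ≤ ‖ξ‖ ^ 2 := pow_le_pow_left₀ (norm_nonneg _) hsξ 2
  nlinarith [mul_nonneg (sub_nonneg.2 h1) (sub_nonneg.2 h2)]

/-- If a closed subspace of a Banach algebra is invariant under multiplication by one of its
elements `a` and omits `1`, then the scalar part of `a + c` is bounded by its norm. -/
theorem norm_le_norm_add_smul_one_of_one_notMem {R : Type*} [NormedRing R] [NormedAlgebra ℂ R]
    {P : Submodule ℂ R} (hP : IsClosed (P : Set R)) (h1 : (1 : R) ∉ P) {a : R} (ha : a ∈ P)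
    (hmul : ∀ p ∈ P, p * a ∈ P) (c : ℂ) : ‖c‖ ≤ ‖a + c • 1‖ := by
  by_contra! hlt
  have hc : c ≠ 0 := by
    rintro rfl
    simp at hlt
    exact absurd hlt (norm_nonneg _).not_gt
  set b : R := c⁻¹ • (a + c • 1) with hb
  have hb' : b = 1 + c⁻¹ • a := by
    rw [hb, smul_add, smul_smul, inv_mul_cancel₀ hc, one_smul, add_comm]
  have hnb : ‖b‖ < 1 := by
    rw [hb, norm_smul, norm_inv, inv_mul_lt_one₀ (norm_pos_iff.2 hc)]
    exact hlt
  -- Since `bⁿ → 0`, this forces the limit `1` into the closed subspace `P`.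
  have hmem : ∀ n : ℕ, 1 - b ^ n ∈ P := by
    intro n
    induction n with
    | zero => simp
    | succ n ih =>
      have : 1 - b ^ (n + 1) = (1 - b ^ n) + c⁻¹ • ((1 - b ^ n) * a) - c⁻¹ • a := by
        rw [pow_succ]
        nth_rw 2 [hb']
        rw [mul_add, mul_one, mul_smul_comm, sub_mul, one_mul, smul_sub]
        abel
      rw [this]
      exact P.sub_mem (P.add_mem ih (P.smul_mem _ (hmul _ ih))) (P.smul_mem _ ha)
  have hlim : Filter.Tendsto (fun n : ℕ => 1 - b ^ n) Filter.atTop (nhds (1 - 0)) :=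
    tendsto_const_nhds.sub (tendsto_pow_atTop_nhds_zero_of_norm_lt_one hnb)
  rw [sub_zero] at hlim
  exact h1 (hP.mem_of_tendsto hlim (Filter.Eventually.of_forall hmem))

theorem jordanProd_eq_mul_of_commute {H : Type*} [NormedAddCommGroup H] [InnerProductSpace ℂ H]
    {a b : H →L[ℂ] H} (h : Commute a b) : jordanProd a b = b * a := by
  rw [jordanProd, h.eq, ← two_smul ℂ (b * a), smul_smul]
  norm_num

theorem jordanProd_add_smul_one {H : Type*} [NormedAddCommGroup H] [InnerProductSpace ℂ H]
    (a b : H →L[ℂ] H) (c d : ℂ) : jordanProd (a + c • 1) (b + d • 1) =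
      jordanProd a b + d • a + c • b + (c * d) • 1 := by
  simp only [jordanProd, mul_add, add_mul, smul_mul_assoc, mul_smul_comm, mul_one, one_mul]
  module

/-! ### The norm inequality -/

namespace JordanOperatorAlgebra

variable {H : Type*} [NormedAddCommGroup H] [InnerProductSpace ℂ H] [CompleteSpace H]
  {K : Type*} [NormedAddCommGroup K] [InnerProductSpace ℂ K] [CompleteSpace K]
  {L : Type*} [NormedAddCommGroup L] [InnerProductSpace ℂ L] [CompleteSpace L]
  {A : JordanOperatorAlgebra H}

instance : CompleteSpace A := A.isClosed'.completeSpace_coe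

/-- The elements of `A` whose images under `f` and `g` commute with the images of `a`. -/
def commutingSubmodule (f : A →ₗ[ℂ] (K →L[ℂ] K)) (g : A →ₗ[ℂ] (L →L[ℂ] L)) (a : A) :
    Submodule ℂ A where
  carrier := {b | Commute (f a) (f b) ∧ Commute (g a) (g b)}
  add_mem' := fun hx hy => by
    simp only [Set.mem_ofPred_eq, map_add] at *
    exact ⟨hx.1.add_right hy.1, hx.2.add_right hy.2⟩
  zero_mem' := by simp
  smul_mem' := fun c x hx => by
    simp only [Set.mem_ofPred_eq, map_smul] at *
    exact ⟨hx.1.smul_right c, hx.2.smul_right c⟩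

theorem isClosed_commutingSubmodule {f : A →ₗ[ℂ] (K →L[ℂ] K)} {g : A →ₗ[ℂ] (L →L[ℂ] L)}
    (hf : Continuous f) (hg : Continuous g) (a : A) :
    IsClosed (commutingSubmodule f g a : Set A) :=
  (isClosed_eq (continuous_const.mul hf) (hf.mul continuous_const)).inter
    (isClosed_eq (continuous_const.mul hg) (hg.mul continuous_const))

/-- On commuting images the Jordan product is the associative one, so power series in `a` make sense
here. Commutation under `g` is imposed along with that under `f`, so that the same relations can
later be read through `g`. -/
theorem jmul_mem_commutingSubmodule {K : Type*} [NormedAddCommGroup K] [InnerProductSpace ℂ K]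
    {L : Type*} [NormedAddCommGroup L] [InnerProductSpace ℂ L] {f : A →ₗ[ℂ] (K →L[ℂ] K)}
    {g : A →ₗ[ℂ] (L →L[ℂ] L)} (hf : ∀ a b, f (jmul a b) = jordanProd (f a) (f b))
    (hg : ∀ a b, g (jmul a b) = jordanProd (g a) (g b)) {a b : A}
    (hb : b ∈ commutingSubmodule f g a) :
    jmul a b ∈ commutingSubmodule f g a := by
  refine ⟨?_, ?_⟩
  · rw [hf, jordanProd_eq_mul_of_commute hb.1]
    exact hb.1.mul_right (Commute.refl _)
  · rw [hg, jordanProd_eq_mul_of_commute hb.2]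
    exact hb.2.mul_right (Commute.refl _)

/-- A contractive Jordan homomorphism stays contractive after adjoining the identity operators,
provided that the domain, represented isometrically, does not contain the identity. -/
theorem norm_add_smul_one_le {f : A →ₗ[ℂ] (K →L[ℂ] K)} {g : A →ₗ[ℂ] (L →L[ℂ] L)}
    (hf : ∀ a b, f (jmul a b) = jordanProd (f a) (f b))
    (hg : ∀ a b, g (jmul a b) = jordanProd (g a) (g b))
    (hfn : ∀ a, ‖f a‖ = ‖a‖) (hgn : ∀ a, ‖g a‖ ≤ ‖a‖) (h1 : ∀ a, f a ≠ 1) (a : A) (c : ℂ) :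
    ‖g a + c • 1‖ ≤ ‖f a + c • 1‖ := by
  have hfi : Isometry f := AddMonoidHomClass.isometry_of_norm f hfn
  have hgc : Continuous g := AddMonoidHomClass.continuous_of_bound g 1 (by simpa using hgn)
  -- it is enough to treat strict contractions
  suffices key : ∀ (a : A) (c : ℂ), ‖f a + c • 1‖ < 1 → ‖g a + c • 1‖ ≤ 1 by
    refine le_of_forall_gt_imp_ge_of_dense fun r hr => ?_
    have hr0 : 0 < r := (norm_nonneg _).trans_lt hr
    have hrn : ‖(r : ℂ)⁻¹‖ = r⁻¹ := by simp [abs_of_pos hr0]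
    have h := key ((r : ℂ)⁻¹ • a) ((r : ℂ)⁻¹ * c)
    rw [map_smul, map_smul, mul_smul, mul_smul, ← smul_add, ← smul_add, norm_smul, norm_smul,
      hrn, inv_mul_lt_one₀ hr0, inv_mul_le_one₀ hr0] at h
    exact h hr
  intro a c hx
  set N := commutingSubmodule f g a
  set P : Submodule ℂ (K →L[ℂ] K) := N.map f
  have hPc : IsClosed (P : Set (K →L[ℂ] K)) := by
    rw [Submodule.map_coe]
    exact hfi.isClosedEmbedding.isClosedMap _ (isClosed_commutingSubmodule hfi.continuous hgc a)
  have haP : f a ∈ P := ⟨a, ⟨Commute.refl _, Commute.refl _⟩, rfl⟩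
  have hPmul : ∀ p ∈ P, p * f a ∈ P := by
    rintro _ ⟨b, hb, rfl⟩
    refine ⟨jmul a b, jmul_mem_commutingSubmodule hf hg hb, ?_⟩
    rw [hf, jordanProd_eq_mul_of_commute hb.1]
  have hP1 : (1 : K →L[ℂ] K) ∉ P := by
    rintro ⟨b, -, hb⟩
    exact h1 b hb
  have hc : ‖c‖ < 1 := (norm_le_norm_add_smul_one_of_one_notMem hPc hP1 haP hPmul c).trans_lt hx
  set x : K →L[ℂ] K := f a + c • 1 with hxdef
  have hlt : ‖(starRingEnd ℂ) c • x‖ < 1 := by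
    rw [norm_smul, RCLike.norm_conj]
    exact (mul_le_of_le_one_right (norm_nonneg _) hx.le).trans_lt hc
  -- Here `f a = x - c`, so `f y` is the Möbius transform of `x`. The Neumann series for the inverse
  -- keeps it in the closed subspace `P`.
  obtain ⟨y, hyN, hy⟩ : ∃ y ∈ N, f y * (1 - (starRingEnd ℂ) c • x) = f a := by
    set q := (starRingEnd ℂ) c • x with hq
    have hmem : ∀ n : ℕ, f a * q ^ n ∈ P := by
      intro n
      induction n with
      | zero => simpa using haP
      | succ n ih =>
        rw [pow_succ, ← mul_assoc]
        generalize f a * q ^ n = p at ih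
        rw [hq, hxdef, mul_smul_comm, mul_add, mul_smul_comm, mul_one]
        exact P.smul_mem _ (P.add_mem (hPmul _ ih) (P.smul_mem _ ih))
    have hsum : HasSum (fun n : ℕ => f a * q ^ n) (f a * ∑' n : ℕ, q ^ n) :=
      (summable_geometric_of_norm_lt_one hlt).hasSum.mul_left _
    have hlim : f a * ∑' n : ℕ, q ^ n ∈ P :=
      hPc.mem_of_tendsto hsum (Filter.Eventually.of_forall fun s =>
        P.sum_mem fun n _ => hmem n)
    obtain ⟨y, hyN, hy⟩ := hlim
    refine ⟨y, hyN, ?_⟩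
    rw [hy, mul_assoc, geom_series_mul_neg q hlt, mul_one]
  have hyn : ‖y‖ ≤ 1 := by
    rw [← hfn]
    refine norm_le_one_of_mul_one_add_conj_smul (s := x) (c := -c) hx.le (by simpa using hc) ?_
    rw [map_neg, neg_smul, ← sub_eq_add_neg, hy, hxdef]
    module
  -- Clearing the denominator leaves an identity in `A` itself, without units or inverses, to which
  -- `g` applies.
  have hrel : a = (1 - (starRingEnd ℂ) c * c) • y - (starRingEnd ℂ) c • jmul a y := by
    apply hfi.injective
    rw [map_sub, map_smul, map_smul, hf, jordanProd_eq_mul_of_commute hyN.1]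
    conv_lhs => rw [← hy]
    rw [hxdef, mul_sub, mul_one, mul_smul_comm, mul_add, mul_smul_comm, mul_one]
    module
  refine norm_le_one_of_mul_one_add_conj_smul (s := g y) ((hgn y).trans hyn) hc ?_
  have hga := congrArg g hrel
  rw [map_sub, map_smul, map_smul, hg, jordanProd_eq_mul_of_commute hyN.2] at hga
  rw [mul_add, mul_one, add_mul, mul_smul_comm, smul_mul_assoc, one_mul, hyN.2.eq]
  nth_rw 1 [hga]
  module

/-! ### Extension along a unitization -/

theorem IsUnitization.norm_eq {U : JordanOperatorAlgebra L} {j : A →ₗ[ℂ] U}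
    (h : IsUnitization U j) (a : A) : ‖(j a : L →L[ℂ] L)‖ = ‖a‖ := h.norm_map a

/-- Two decompositions of an element of a unitization agree. -/
theorem IsUnitization.decomposition_injective {U : JordanOperatorAlgebra L} {j : A →ₗ[ℂ] U}
    (h : IsUnitization U j) {a b : A} {c d : ℂ}
    (hab : (j a : L →L[ℂ] L) + c • 1 = (j b : L →L[ℂ] L) + d • 1) : a = b ∧ c = d := by
  have hsub : (j (a - b) : L →L[ℂ] L) = (d - c) • 1 := by
    rw [map_sub, Submodule.coe_sub, sub_smul, sub_eq_sub_iff_add_eq_add, hab, add_comm]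
  have hcd : d - c = 0 := by
    by_contra hne
    refine h.one_ne ((d - c)⁻¹ • (a - b)) ?_
    rw [map_smul, Submodule.coe_smul, hsub, smul_smul, inv_mul_cancel₀ hne, one_smul]
  rw [hcd, zero_smul] at hsub
  have h0 : ‖a - b‖ = 0 := by rw [← h.norm_eq, hsub, norm_zero]
  exact ⟨sub_eq_zero.1 (norm_eq_zero.1 h0), (sub_eq_zero.1 hcd).symm⟩

/-- Jordan homomorphisms into an algebra containing the identity extend to unitizations. -/
theorem IsUnitization.exists_extension {U : JordanOperatorAlgebra L} {j : A →ₗ[ℂ] U}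
    (h : IsUnitization U j) {V : JordanOperatorAlgebra K} (hV : (1 : K →L[ℂ] K) ∈ V.toSubmodule)
    {k : A →ₗ[ℂ] V} (hk : IsJordanHom k) :
    ∃ S : U →ₗ[ℂ] V, IsJordanHom S ∧ ∀ (x : U) (a : A) (c : ℂ),
      (x : L →L[ℂ] L) = (j a : L →L[ℂ] L) + c • 1 →
        (S x : K →L[ℂ] K) = (k a : K →L[ℂ] K) + c • 1 := by
  choose α γ hαγ using h.exists_eq
  have hval : ∀ (x : U) (a : A) (c : ℂ),
      (x : L →L[ℂ] L) = (j a : L →L[ℂ] L) + c • 1 → α x = a ∧ γ x = c :=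
    fun x a c hx => h.decomposition_injective ((hαγ x).symm.trans hx)
  have hadd : ∀ x y, α (x + y) = α x + α y ∧ γ (x + y) = γ x + γ y := fun x y => by
    refine hval _ _ _ ?_
    rw [Submodule.coe_add, hαγ x, hαγ y, map_add, Submodule.coe_add]
    module
  have hsmul : ∀ (c : ℂ) x, α (c • x) = c • α x ∧ γ (c • x) = c * γ x := fun c x => by
    refine hval _ _ _ ?_
    rw [Submodule.coe_smul, hαγ x, map_smul, Submodule.coe_smul]
    module
  have hmul : ∀ x y, α (jmul x y) = jmul (α x) (α y) + γ y • α x + γ x • α y ∧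
      γ (jmul x y) = γ x * γ y := fun x y => by
    refine hval _ _ _ ?_
    rw [map_add, map_add, map_smul, map_smul, h.isJordanHom]
    change jordanProd (x : L →L[ℂ] L) y = jordanProd (j (α x) : L →L[ℂ] L) (j (α y)) +
      γ y • (j (α x) : L →L[ℂ] L) + γ x • (j (α y) : L →L[ℂ] L) + (γ x * γ y) • 1
    rw [hαγ x, hαγ y, jordanProd_add_smul_one]
  let S : U →ₗ[ℂ] V :=
    { toFun := fun x => k (α x) + γ x • ⟨1, hV⟩
      map_add' := fun x y => by
        rw [(hadd x y).1, (hadd x y).2, map_add]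
        module
      map_smul' := fun c x => by
        rw [(hsmul c x).1, (hsmul c x).2, map_smul, RingHom.id_apply]
        module }
  refine ⟨S, fun x y => ?_, fun x a c hx => ?_⟩
  · apply Subtype.ext
    change ((k (α (jmul x y)) : V) : K →L[ℂ] K) + γ (jmul x y) • 1 =
      jordanProd ((k (α x) : K →L[ℂ] K) + γ x • 1) ((k (α y) : K →L[ℂ] K) + γ y • 1)
    rw [(hmul x y).1, (hmul x y).2, map_add, map_add, map_smul, map_smul, hk,
      jordanProd_add_smul_one]
    rfl
  · change (k (α x) : K →L[ℂ] K) + γ x • 1 = _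
    rw [(hval x a c hx).1, (hval x a c hx).2]

/-- A contractive Jordan homomorphism decreases the norm of a unitization. -/
theorem IsUnitization.norm_add_smul_one_le {U : JordanOperatorAlgebra L} {j : A →ₗ[ℂ] U}
    (h : IsUnitization U j) {V : JordanOperatorAlgebra K} {k : A →ₗ[ℂ] V} (hk : IsJordanHom k)
    (hkn : ∀ a, ‖k a‖ ≤ ‖a‖) (a : A) (c : ℂ) :
    ‖(k a : K →L[ℂ] K) + c • 1‖ ≤ ‖(j a : L →L[ℂ] L) + c • 1‖ := by
  let f : A →ₗ[ℂ] (L →L[ℂ] L) := U.toSubmodule.subtype ∘ₗ j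
  let g : A →ₗ[ℂ] (K →L[ℂ] K) := V.toSubmodule.subtype ∘ₗ k
  have hf : ∀ a b, f (jmul a b) = jordanProd (f a) (f b) := fun a b =>
    congrArg Subtype.val (h.isJordanHom a b)
  have hg : ∀ a b, g (jmul a b) = jordanProd (g a) (g b) := fun a b =>
    congrArg Subtype.val (hk a b)
  exact JordanOperatorAlgebra.norm_add_smul_one_le hf hg h.norm_map hkn h.one_ne a c

theorem isUnitization_adjoinOne (h : (1 : H →L[ℂ] H) ∉ A.toSubmodule) :
    IsUnitization A.adjoinOne A.toAdjoinOne where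
  one_mem := A.adjoinOneOne.2
  isJordanHom _ _ := rfl
  norm_map _ := rfl
  one_ne a ha := h (by rw [← ha]; exact a.2)
  exists_eq x := by
    obtain ⟨a, ha, s, hs, hx⟩ := Submodule.mem_sup.1 x.2
    obtain ⟨c, rfl⟩ := Submodule.mem_span_singleton.1 hs
    exact ⟨⟨a, ha⟩, c, hx.symm⟩

/-! ### Existence of unitizations -/

/-- The range of an isometric Jordan homomorphism is a Jordan operator algebra. -/
def range (f : A →ₗ[ℂ] (K →L[ℂ] K)) (hf : ∀ a b, f (jmul a b) = jordanProd (f a) (f b))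
    (hfn : ∀ a, ‖f a‖ = ‖a‖) : JordanOperatorAlgebra K where
  toSubmodule := LinearMap.range f
  isClosed' := by
    rw [LinearMap.coe_range]
    exact (AddMonoidHomClass.isometry_of_norm f hfn).isClosedEmbedding.isClosed_range
  jordanProd_mem' := by
    rintro _ ⟨a, rfl⟩ _ ⟨b, rfl⟩
    exact ⟨jmul a b, hf a b⟩

/-- An isometric representation that omits the identity gives rise to a unitization. -/
theorem exists_isUnitization_of_representation {f : A →ₗ[ℂ] (K →L[ℂ] K)}
    (hf : ∀ a b, f (jmul a b) = jordanProd (f a) (f b))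
    (hfn : ∀ a, ‖f a‖ = ‖a‖) (h1 : ∀ a, f a ≠ 1) :
    ∃ (U : JordanOperatorAlgebra K) (j : A →ₗ[ℂ] U), IsUnitization U j := by
  have hU : IsUnitization (range f hf hfn).adjoinOne (range f hf hfn).toAdjoinOne :=
    isUnitization_adjoinOne (by rintro ⟨a, ha⟩; exact h1 a ha)
  refine ⟨_, (range f hf hfn).toAdjoinOne ∘ₗ f.rangeRestrict, hU.one_mem, fun a b => ?_,
    hfn, h1, fun x => ?_⟩
  · exact Subtype.ext (hf a b)
  · obtain ⟨⟨_, a, rfl⟩, c, hx⟩ := hU.exists_eq x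
    exact ⟨a, c, hx⟩

/-- Adding a one-dimensional summand on which `A` acts by zero yields a unitization. -/
theorem exists_isUnitization {H : Type u} [NormedAddCommGroup H] [InnerProductSpace ℂ H]
    [CompleteSpace H] (A : JordanOperatorAlgebra H) :
    ∃ (L : Type u) (_ : NormedAddCommGroup L) (_ : InnerProductSpace ℂ L) (_ : CompleteSpace L)
      (U : JordanOperatorAlgebra L) (j : A →ₗ[ℂ] U), IsUnitization U j := by
  let E := EuclideanSpace ℂ PUnit.{u + 1}
  let e : WithLp 2 (H × E) ≃L[ℂ] H × E := WithLp.prodContinuousLinearEquiv 2 ℂ H E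
  let V : H →L[ℂ] WithLp 2 (H × E) := e.symm.toContinuousLinearMap ∘L .inl ℂ H E
  let Q : WithLp 2 (H × E) →L[ℂ] H := .fst ℂ H E ∘L e.toContinuousLinearMap
  have hQV : ∀ ξ, Q (V ξ) = ξ := fun ξ => by simp [Q, V]
  have hV : ∀ ξ, ‖V ξ‖ = ‖ξ‖ := fun ξ => by
    simp [V, e]
  have hQ : ∀ η, ‖Q η‖ ≤ ‖η‖ := fun η => by
    refine le_of_sq_le_sq ?_ (norm_nonneg _)
    rw [WithLp.prod_norm_sq_eq_of_L2]
    exact le_add_of_nonneg_right (sq_nonneg _)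
  let f : A →ₗ[ℂ] (WithLp 2 (H × E) →L[ℂ] WithLp 2 (H × E)) :=
    { toFun := fun a => V ∘L (a : H →L[ℂ] H) ∘L Q
      map_add' := fun a b => by ext1 η; simp
      map_smul' := fun c a => by ext1 η; simp }
  have hfa : ∀ a η, f a η = V ((a : H →L[ℂ] H) (Q η)) := fun _ _ => rfl
  refine ⟨WithLp 2 (H × E), inferInstance, inferInstance, inferInstance,
    exists_isUnitization_of_representation (f := f) (fun a b => ?_) (fun a => ?_) fun a ha => ?_⟩
  · ext1 η
    simp [hfa, jordanProd, jmul, hQV]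
  · apply le_antisymm
    · refine ContinuousLinearMap.opNorm_le_bound _ (norm_nonneg _) fun η => ?_
      rw [hfa, hV]
      exact ((a : H →L[ℂ] H).le_opNorm _).trans
        (mul_le_mul_of_nonneg_left (hQ η) (norm_nonneg _))
    · refine ContinuousLinearMap.opNorm_le_bound (a : H →L[ℂ] H) (norm_nonneg _) fun ξ => ?_
      have := (f a).le_opNorm (V ξ)
      rwa [hfa, hV, hV, hQV] at this
  -- A nonzero vector of the added summand is killed by every `f a`, so no `f a` is the identity.
  · let η : WithLp 2 (H × E) := e.symm (0, EuclideanSpace.single PUnit.unit 1)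
    have h0 : Q η = 0 := by simp [Q, η]
    have h2 : η = 0 := by
      have := hfa a η
      rw [h0, map_zero, map_zero, ha] at this
      exact this
    have h3 : (e η).2 PUnit.unit = 0 := by rw [h2, map_zero]; rfl
    simp [η] at h3

end JordanOperatorAlgebra

open JordanOperatorAlgebra in
theorem corollary2p4
    {H : Type u} [NormedAddCommGroup H] [InnerProductSpace ℂ H] [CompleteSpace H]
    {K : Type v} [NormedAddCommGroup K] [InnerProductSpace ℂ K] [CompleteSpace K]
    (A : JordanOperatorAlgebra H) (B : JordanOperatorAlgebra K) :
    -- contractive Jordan homomorphisms extend to the unitizations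
    ((1 : H →L[ℂ] H) ∉ A.toSubmodule →
      ∀ T : A →ₗ[ℂ] B, IsJordanHom T → (∀ a : A, ‖T a‖ ≤ ‖a‖) →
        ∃ S : A.adjoinOne →ₗ[ℂ] B.adjoinOne, IsJordanHom S ∧
          S A.adjoinOneOne = B.adjoinOneOne ∧
          (∀ a : A, S (A.toAdjoinOne a) = B.toAdjoinOne (T a)) ∧
          ∀ x : A.adjoinOne, ‖S x‖ ≤ ‖x‖) ∧
    -- isometric Jordan homomorphisms extend isometrically to the unitizations
    ((1 : H →L[ℂ] H) ∉ A.toSubmodule → (1 : K →L[ℂ] K) ∉ B.toSubmodule →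
      ∀ T : A →ₗ[ℂ] B, IsJordanHom T → (∀ a : A, ‖T a‖ = ‖a‖) →
        ∃ S : A.adjoinOne →ₗ[ℂ] B.adjoinOne, IsJordanHom S ∧
          S A.adjoinOneOne = B.adjoinOneOne ∧
          (∀ a : A, S (A.toAdjoinOne a) = B.toAdjoinOne (T a)) ∧
          ∀ x : A.adjoinOne, ‖S x‖ = ‖x‖) ∧
    -- if `I_H ∉ A`, then `A + ℂ I_H` is a unitization of `A`
    ((1 : H →L[ℂ] H) ∉ A.toSubmodule → IsUnitization A.adjoinOne A.toAdjoinOne) ∧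
    -- every Jordan operator algebra has a unitization
    (∃ (L : Type u) (_ : NormedAddCommGroup L) (_ : InnerProductSpace ℂ L) (_ : CompleteSpace L)
      (U : JordanOperatorAlgebra L) (j : A →ₗ[ℂ] U), IsUnitization U j) ∧
    -- any two unitizations are isometrically Jordan isomorphic over `A`
    (∀ (L₁ : Type w) [NormedAddCommGroup L₁] [InnerProductSpace ℂ L₁] [CompleteSpace L₁]
      (L₂ : Type x) [NormedAddCommGroup L₂] [InnerProductSpace ℂ L₂] [CompleteSpace L₂]
      (U₁ : JordanOperatorAlgebra L₁) (U₂ : JordanOperatorAlgebra L₂)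
      (j₁ : A →ₗ[ℂ] U₁) (j₂ : A →ₗ[ℂ] U₂)
      (h₁ : IsUnitization U₁ j₁) (h₂ : IsUnitization U₂ j₂),
      ∃ φ : U₁ ≃ₗᵢ[ℂ] U₂, IsJordanHom (φ.toLinearEquiv : U₁ →ₗ[ℂ] U₂) ∧
        φ ⟨1, h₁.one_mem⟩ = ⟨1, h₂.one_mem⟩ ∧
        ∀ a : A, φ (j₁ a) = j₂ a) := by
  have hB : IsJordanHom B.toAdjoinOne := fun _ _ => rfl
  have extend : (1 : H →L[ℂ] H) ∉ A.toSubmodule → ∀ T : A →ₗ[ℂ] B, IsJordanHom T →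
      ∃ S : A.adjoinOne →ₗ[ℂ] B.adjoinOne, IsJordanHom S ∧
        S A.adjoinOneOne = B.adjoinOneOne ∧
        (∀ a : A, S (A.toAdjoinOne a) = B.toAdjoinOne (T a)) ∧
        ∀ x : A.adjoinOne, ∃ (a : A) (c : ℂ),
          (x : H →L[ℂ] H) = (a : H →L[ℂ] H) + c • 1 ∧
          (S x : K →L[ℂ] K) = (T a : K →L[ℂ] K) + c • 1 := by
    intro h T hT
    have hU := isUnitization_adjoinOne h
    obtain ⟨S, hS, hSv⟩ := hU.exists_extension B.adjoinOneOne.2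
      (k := B.toAdjoinOne ∘ₗ T) fun a b => by simp [hT a b, hB _ _]
    refine ⟨S, hS, Subtype.ext ?_, fun a => Subtype.ext ?_, fun x => ?_⟩
    · rw [hSv _ 0 1 (by simp [adjoinOneOne])]
      simp [adjoinOneOne]
    · rw [hSv _ a 0 (by simp)]
      simp
    · obtain ⟨a, c, hx⟩ := hU.exists_eq x
      exact ⟨a, c, hx, hSv x a c hx⟩
  refine ⟨fun h T hT hTn => ?_, fun h h' T hT hTn => ?_, isUnitization_adjoinOne,
    exists_isUnitization A, ?_⟩
  · obtain ⟨S, hS, hS1, hST, hSn⟩ := extend h T hT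
    refine ⟨S, hS, hS1, hST, fun x => ?_⟩
    obtain ⟨a, c, hx, hSx⟩ := hSn x
    rw [← Submodule.norm_coe, ← Submodule.norm_coe, hx, hSx]
    exact norm_add_smul_one_le (f := A.toSubmodule.subtype) (g := B.toSubmodule.subtype ∘ₗ T)
      (fun _ _ => rfl) (fun a b => congrArg Subtype.val (hT a b)) (fun _ => rfl) hTn
      (fun a ha => h (ha ▸ a.2)) a c
  · obtain ⟨S, hS, hS1, hST, hSn⟩ := extend h T hT
    refine ⟨S, hS, hS1, hST, fun x => ?_⟩
    obtain ⟨a, c, hx, hSx⟩ := hSn x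
    rw [← Submodule.norm_coe, ← Submodule.norm_coe, hx, hSx]
    apply le_antisymm
    · exact norm_add_smul_one_le (f := A.toSubmodule.subtype) (g := B.toSubmodule.subtype ∘ₗ T)
        (fun _ _ => rfl) (fun a b => congrArg Subtype.val (hT a b)) (fun _ => rfl)
        (fun a => (hTn a).le) (fun a ha => h (ha ▸ a.2)) a c
    -- The reverse inequality swaps the two representations of `A`; this is where `I_K ∉ B` enters.
    · exact norm_add_smul_one_le (f := B.toSubmodule.subtype ∘ₗ T) (g := A.toSubmodule.subtype)
        (fun a b => congrArg Subtype.val (hT a b)) (fun _ _ => rfl) hTn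
        (fun _ => le_rfl) (fun a ha => h' (ha ▸ (T a).2)) a c
  · intro L₁ _ _ _ L₂ _ _ _ U₁ U₂ j₁ j₂ h₁ h₂
    obtain ⟨S, hS, hSv⟩ := h₁.exists_extension h₂.one_mem h₂.isJordanHom
    obtain ⟨R, -, hRv⟩ := h₂.exists_extension h₁.one_mem h₁.isJordanHom
    have hRS : ∀ x, R (S x) = x := fun x => by
      obtain ⟨a, c, hx⟩ := h₁.exists_eq x
      exact Subtype.ext ((hRv _ a c (hSv x a c hx)).trans hx.symm)
    have hSR : ∀ x, S (R x) = x := fun x => by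
      obtain ⟨a, c, hx⟩ := h₂.exists_eq x
      exact Subtype.ext ((hSv _ a c (hRv x a c hx)).trans hx.symm)
    have hn : ∀ x, ‖S x‖ = ‖x‖ := fun x => by
      obtain ⟨a, c, hx⟩ := h₁.exists_eq x
      rw [← Submodule.norm_coe, ← Submodule.norm_coe, hSv x a c hx, hx]
      exact le_antisymm
        (h₁.norm_add_smul_one_le h₂.isJordanHom (fun a => (h₂.norm_map a).le) a c)
        (h₂.norm_add_smul_one_le h₁.isJordanHom (fun a => (h₁.norm_map a).le) a c)
    refine ⟨⟨LinearEquiv.ofLinearMap S R (LinearMap.ext hSR) (LinearMap.ext hRS), hn⟩, hS,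
      Subtype.ext ?_, fun a => Subtype.ext ?_⟩
    · exact (hSv _ 0 1 (by simp)).trans (by simp)
    · exact (hSv _ a 0 (by simp)).trans (by simp)
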